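/- Let $R$ be a commutative noetherian ring and let $\mathrm{mod}\text{-}R$ be the abelian category of finitely generated (equivalently, finitely presented) $R$-modules. A Serre subcategory of $\mathrm{mod}\text{-}R$ is a nonempty full subcategory closed under subobjects, quotients and extensions; let $\mathrm{Ser}(\mathrm{mod}\text{-}R)$ be the set of all of them, ordered by inclusion, with meet $\mathcal S\wedge\mathcal S'=\mathcal S\cap\mathcal S'$. Call $\mathcal S\in\mathrm{Ser}(\mathrm{mod}\text{-}R)$ prime if $\mathcal S\neq\mathrm{mod}\text{-}R$ and, for all $\mathcal T,\mathcal T'\in\mathrm{Ser}(\mathrm{mod}\text{-}R)$, $\mathcal T\cap\mathcal T'\subseteq\mathcal S$ implies $\mathcal T\subseteq\mathcal S$ or $\mathcal T'\subseteq\mathcal S$. Call it $\wedge$-irreducible if $\mathcal S\neq\mathrm{mod}\text{-}R$ and $\mathcal S=\mathcal T\cap\mathcal T'$ implies $\mathcal S=\mathcal T$ or $\mathcal S=\mathcal T'$. Let $\mathrm{Sp}(\mathrm{mod}\text{-}R)$ be the set of prime elements of $\mathrm{Ser}(\mathrm{mod}\text{-}R)$, ordered by inclusion. For a prime ideal $P$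 of $R$ let $E(R/P)$ denote the injective hull of $R/P$. Then an element of $\mathrm{Ser}(\mathrm{mod}\text{-}R)$ is prime if and only if it is $\wedge$-irreducible, and the assignment $$P\longmapsto \mathcal S_P=\{A\in\mathrm{mod}\text{-}R : \mathrm{Hom}_R(A,E(R/P))=0\}$$ is a bijection $\mathrm{Spec}(R)\to\mathrm{Sp}(\mathrm{mod}\text{-}R)$. It reverses inclusion: for all $P,Q\in\mathrm{Spec}(R)$, $\mathcal S_P\subseteq\mathcal S_Q$ if and only if $Q\subseteq P$. Equivalently, $\mathcal S_P\subseteq\mathcal S_Q$ if and only if $P\in\mathrm{cl}\{Q\}$ in the Zariski topology on $\mathrm{Spec}(R)$; so the bijection is an isomorphism of ordered sets when $\mathrm{Spec}(R)$ carries the specialisation order ($P\leq Q$ iff $P\in\mathrm{cl}\{Q\}$). -/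

import Mathlib

open CategoryTheory

universe u v

/-! ### Serre subcategories of an abelian category -/

section Serre

variable (C : Type u) [Category.{v} C] [Abelian C]

/-- `Ser(C)`: the Serre subcategories of the abelian category `C` (nonempty full subcategories
closed under subobjects, quotients and extensions), ordered by inclusion. -/
def SerreSubcategory : Type u :=
  { S : ObjectProperty C // S.IsSerreClass }

instance : PartialOrder (SerreSubcategory C) :=
  inferInstanceAs (PartialOrder { S : ObjectProperty C // S.IsSerreClass })

variable {C}

theorem isSerreClass_inf {S T : ObjectProperty C} (hS : S.IsSerreClass) (hT : T.IsSerreClass) :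
    (S ⊓ T).IsSerreClass where
  exists_zero := ⟨_, Limits.isZero_zero C,
    S.prop_of_isZero (Limits.isZero_zero C), T.prop_of_isZero (Limits.isZero_zero C)⟩
  prop_of_mono f _ h := ⟨S.prop_of_mono f h.1, T.prop_of_mono f h.2⟩
  prop_of_epi f _ h := ⟨S.prop_of_epi f h.1, T.prop_of_epi f h.2⟩
  prop_X₂_of_shortExact hE h₁ h₃ :=
    ⟨S.prop_X₂_of_shortExact hE h₁.1 h₃.1, T.prop_X₂_of_shortExact hE h₁.2 h₃.2⟩

variable (C)

/-- The meet of two Serre subcategories is their intersection. -/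
instance : SemilatticeInf (SerreSubcategory C) where
  inf S T := ⟨S.1 ⊓ T.1, isSerreClass_inf S.2 T.2⟩
  inf_le_left _ _ := fun _ h => h.1
  inf_le_right _ _ := fun _ h => h.2
  le_inf _ _ _ h₁ h₂ := fun A h => ⟨h₁ A h, h₂ A h⟩

/-- `Sp(C)`: the prime elements of `Ser(C)`, that is, the Serre subcategories `S ≠ C` such that
`T ∩ T' ⊆ S` implies `T ⊆ S` or `T' ⊆ S`; ordered by inclusion. -/
abbrev SerreSpectrum : Type u :=
  { S : SerreSubcategory C // InfPrime S }

end Serre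

/-! ### Injective hulls -/

section Hull

variable {R : Type u} [CommRing R]

/-- A linear map `i : M → E` is an injective hull of `M` if `E` is an injective module, `i` is
injective, and the image of `i` is essential in `E`: it meets every nonzero submodule of `E`
in a nonzero submodule. -/
structure IsInjectiveHull {M E : Type u} [AddCommGroup M] [Module R M] [AddCommGroup E]
    [Module R E] (i : M →ₗ[R] E) : Prop where
  injective_module : Module.Injective R E
  injective_map : Function.Injective i
  essential : ∀ N : Submodule R E, N ⊓ LinearMap.range i = ⊥ → N = ⊥

/-- `E` is an essential extension of `m` inside a bigger module. -/
def EssIn {I : Type u} [AddCommGroup I] [Module R I] (m E : Submodule R I) : Prop :=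
  m ≤ E ∧ ∀ x ∈ E, x ≠ 0 → ∃ r : R, r • x ≠ 0 ∧ r • x ∈ m

/-- Zorn: a largest essential extension exists. -/
theorem exists_max_essIn {I : Type u} [AddCommGroup I] [Module R I]
    (m : Submodule R I) : ∃ E : Submodule R I, EssIn m E ∧ ∀ F, EssIn m F → E ≤ F → F = E := by
  obtain ⟨E, hmE, hE⟩ := zorn_le_nonempty₀ {E : Submodule R I | EssIn m E} (by
    intro c hc hchain y hy
    refine ⟨sSup c, ⟨(hc hy).1.trans (le_sSup hy), ?_⟩, fun z hz => le_sSup hz⟩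
    intro x hx hx0
    obtain ⟨F, hF, hxF⟩ := (Submodule.mem_sSup_of_directed ⟨y, hy⟩ hchain.directedOn).1 hx
    exact (hc hF).2 x hxF hx0) m
    ⟨le_rfl, fun x hx hx0 => ⟨1, by simpa using hx0, by simpa using hx⟩⟩
  exact ⟨E, hE.prop, fun F hF h => le_antisymm (hE.le_of_ge hF h) h⟩

/-- Zorn: a largest submodule disjoint from `E` exists. -/
theorem exists_max_disjoint {I : Type u} [AddCommGroup I] [Module R I]
    (E : Submodule R I) : ∃ N : Submodule R I, Disjoint N E ∧
      ∀ x, x ∉ N → ∃ r : R, ∃ e ∈ E, e ≠ 0 ∧ r • x - e ∈ N := by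
  obtain ⟨N, -, hN⟩ := zorn_le_nonempty₀ {N : Submodule R I | Disjoint N E} (by
    intro c hc hchain y hy
    refine ⟨sSup c, ?_, fun z hz => le_sSup hz⟩
    rw [Set.mem_ofPred_eq, Submodule.disjoint_def]
    intro x hx hxE
    obtain ⟨F, hF, hxF⟩ := (Submodule.mem_sSup_of_directed ⟨y, hy⟩ hchain.directedOn).1 hx
    exact Submodule.disjoint_def.1 (hc hF) x hxF hxE) ⊥ disjoint_bot_left
  refine ⟨N, hN.prop, fun x hx => ?_⟩
  by_contra! hcon
  apply hx
  have hd : Disjoint (N ⊔ Submodule.span R {x}) E := by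
    rw [Submodule.disjoint_def]
    intro e he heE
    by_contra h0
    obtain ⟨n, hn, y, hy, rfl⟩ := Submodule.mem_sup.1 he
    obtain ⟨r, rfl⟩ := Submodule.mem_span_singleton.1 hy
    refine hcon r _ heE h0 ?_
    have : r • x - (n + r • x) = -n := by abel
    rw [this]
    exact N.neg_mem hn
  exact hN.le_of_ge hd le_sup_left
    (Submodule.mem_sup_right (Submodule.mem_span_singleton_self x))

/-- Every module has an injective hull. -/
theorem exists_isInjectiveHull (M : Type u) [AddCommGroup M] [Module R M] :
    ∃ (E : ModuleCat.{u} R) (i : M →ₗ[R] E), IsInjectiveHull i := by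
  let I : ModuleCat.{u} R := Injective.under (ModuleCat.of R M)
  let j : M →ₗ[R] I := (Injective.ι (ModuleCat.of R M)).hom
  have hj : Function.Injective j :=
    (ModuleCat.mono_iff_injective (Injective.ι (ModuleCat.of R M))).1 inferInstance
  have hI : Module.Injective R I := by
    have : Injective (ModuleCat.of R I) := inferInstanceAs (Injective (Injective.under _))
    exact Module.injective_module_of_injective_object R I
  obtain ⟨E, hE, hmax⟩ := exists_max_essIn (LinearMap.range j)
  obtain ⟨N, hNE, hN⟩ := exists_max_disjoint E
  have hg : Function.Injective (N.mkQ ∘ₗ E.subtype) := by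
    rw [injective_iff_map_eq_zero]
    intro e he
    have he' : (e : I) ∈ N := by simpa using he
    exact Subtype.ext (Submodule.disjoint_def.1 hNE _ he' e.2)
  obtain ⟨h, hh⟩ := hI.out (N.mkQ ∘ₗ E.subtype) hg E.subtype
  have key : ∀ y : I ⧸ N, y ≠ 0 → ∃ r : R, r • h y ∈ E ∧ r • h y ≠ 0 := by
    intro y hy
    obtain ⟨x, rfl⟩ := N.mkQ_surjective y
    have hx : x ∉ N := fun hx => hy (by simpa using hx)
    obtain ⟨r, e, heE, he0, hre⟩ := hN x hx
    have h1 : r • N.mkQ x = N.mkQ e := by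
      rw [← map_smul, ← sub_eq_zero, ← map_sub]
      exact (Submodule.Quotient.mk_eq_zero N).2 hre
    have h2 : r • h (N.mkQ x) = e := by
      rw [← map_smul, h1]
      exact hh ⟨e, heE⟩
    exact ⟨r, by rwa [h2], by rwa [h2]⟩
  have hEr : E ≤ LinearMap.range h := fun e he => ⟨N.mkQ e, hh ⟨e, he⟩⟩
  have hr : LinearMap.range h = E := by
    refine hmax _ ⟨hE.1.trans hEr, ?_⟩ hEr
    rintro _ ⟨y, rfl⟩ hz
    obtain ⟨r, hrE, hr0⟩ := key y (fun hy => hz (by rw [hy, map_zero]))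
    obtain ⟨s, hs0, hs⟩ := hE.2 _ hrE hr0
    exact ⟨s * r, by rwa [mul_smul], by rwa [mul_smul]⟩
  let ρ : I →ₗ[R] E := (h ∘ₗ N.mkQ).codRestrict E (fun x => hr ▸ ⟨N.mkQ x, rfl⟩)
  have hρ : ∀ e : E, ρ e = e := fun e => Subtype.ext (hh e)
  refine ⟨ModuleCat.of R E, j.codRestrict E (fun x => hE.1 ⟨x, rfl⟩), ⟨⟨?_⟩, ?_, ?_⟩⟩
  · intro X Y _ _ _ _ f hf g
    obtain ⟨k, hk⟩ := hI.out f hf (E.subtype ∘ₗ g)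
    exact ⟨ρ ∘ₗ k, fun x => by
      rw [LinearMap.comp_apply, hk]
      exact hρ (g x)⟩
  · intro a b hab
    exact hj (congrArg Subtype.val hab)
  · intro K hK
    rw [eq_bot_iff]
    intro x hx
    by_contra hx0
    obtain ⟨r, hr0, t, ht⟩ := hE.2 x.1 x.2 (fun h0 => hx0 (Subtype.ext h0))
    have hmem : r • x ∈ K ⊓ LinearMap.range (j.codRestrict E (fun x => hE.1 ⟨x, rfl⟩)) :=
      ⟨K.smul_mem r hx, t, Subtype.ext ht⟩
    rw [hK] at hmem
    exact hr0 (congrArg Subtype.val ((Submodule.mem_bot R).1 hmem))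

variable (R)

/-- The injective hull `E(M)` of a module `M` (unique up to isomorphism over `M`). -/
noncomputable def injectiveHull (M : Type u) [AddCommGroup M] [Module R M] : ModuleCat.{u} R :=
  (exists_isInjectiveHull (R := R) M).choose

/-- The embedding of a module in its injective hull. -/
noncomputable def toInjectiveHull (M : Type u) [AddCommGroup M] [Module R M] :
    M →ₗ[R] injectiveHull R M :=
  (exists_isInjectiveHull (R := R) M).choose_spec.choose

theorem isInjectiveHull_toInjectiveHull (M : Type u) [AddCommGroup M] [Module R M] :
    IsInjectiveHull (toInjectiveHull R M) :=
  (exists_isInjectiveHull (R := R) M).choose_spec.choose_spec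

end Hull

/-!
A Serre subcategory `S` of `mod-R` is determined by the set `S.primes` of the prime ideals `P` with
`R ⧸ P ∈ S`: a finitely generated module `M` lies in `S` if and only if its support is contained in
`S.primes` (`SerreSubcategory.prop_iff_support_subset`). In one direction, a point `P` of the
support contains the annihilator of some `m : M`, so that `R ⧸ P` is a quotient of the submodule
`R m`; in the other one uses a filtration of `M` with factors of the form `R ⧸ P`.
Conversely, every set `W` of primes gives the Serre subcategory `SerreSubcategory.ofSupport W` of
the modules supported in `W`, and intersections of sets go to intersections of subcategories.

A nonzero map from `M` to `E(R ⧸ P)` exists if and only if `P` is in the support of `M`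
(`exists_linearMap_ne_zero_iff_mem_support`). So `S_P` consists of the modules whose support avoids
`P`, that is, it is `SerreSubcategory.avoiding P`. It is prime because it is the largest Serre
subcategory that does not contain `R ⧸ P`.

Finally, every `∧`-irreducible `S` is of this form. As `R` is noetherian, there is a maximal prime
`P` outside `S.primes`. All the primes properly containing `P` are in `S.primes`, so that
`S.primes` is the intersection of `S.primes ∪ V(P)` and `S.primes ∪ {Q | ¬ Q ≤ P}`;
irreducibility leaves `S.primes = {Q | ¬ Q ≤ P}`.
-/

/-! ### Monomorphisms, epimorphisms and exact sequences of finitely generated modules -/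

namespace FGModuleCat

variable {R : Type u} [CommRing R] [IsNoetherianRing R]

theorem injective_of_mono {A B : FGModuleCat.{u} R} (f : A ⟶ B) [Mono f] :
    Function.Injective f.hom.hom :=
  (ModuleCat.mono_iff_injective ((forget₂ (FGModuleCat R) (ModuleCat.{u} R)).map f)).1
    inferInstance

theorem surjective_of_epi {A B : FGModuleCat.{u} R} (f : A ⟶ B) [Epi f] :
    Function.Surjective f.hom.hom :=
  (ModuleCat.epi_iff_surjective ((forget₂ (FGModuleCat R) (ModuleCat.{u} R)).map f)).1
    inferInstance

theorem function_exact_of_shortExact {S : ShortComplex (FGModuleCat.{u} R)} (hS : S.ShortExact) :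
    Function.Exact S.f.hom.hom S.g.hom.hom :=
  (ShortComplex.ShortExact.moduleCat_exact_iff_function_exact _).1
    (hS.map_of_exact (forget₂ (FGModuleCat R) (ModuleCat.{u} R))).exact

variable {M N K : Type u} [AddCommGroup M] [Module R M] [Module.Finite R M]
  [AddCommGroup N] [Module R N] [Module.Finite R N]
  [AddCommGroup K] [Module R K] [Module.Finite R K]

theorem mono_ofHom {f : M →ₗ[R] N} (hf : Function.Injective f) : Mono (ofHom f) :=
  (forget₂ (FGModuleCat R) (ModuleCat.{u} R)).mono_of_mono_map
    ((ModuleCat.mono_iff_injective (ModuleCat.ofHom f)).2 hf)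

theorem epi_ofHom {f : M →ₗ[R] N} (hf : Function.Surjective f) : Epi (ofHom f) :=
  (forget₂ (FGModuleCat R) (ModuleCat.{u} R)).epi_of_epi_map
    ((ModuleCat.epi_iff_surjective (ModuleCat.ofHom f)).2 hf)

theorem exact_of_function_exact {f : M →ₗ[R] N} {g : N →ₗ[R] K} (h : Function.Exact f g) :
    (ShortComplex.mk (ofHom f) (ofHom g) (hom_ext h.linearMap_comp_eq_zero)).Exact :=
  (forget₂ (FGModuleCat R) (ModuleCat.{u} R)).reflects_exact_of_faithful _
    ((ShortComplex.ShortExact.moduleCat_exact_iff_function_exact _).2 h)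

end FGModuleCat

/-! ### Serre subcategories and supports -/

theorem PrimeSpectrum.mem_support_quotient_iff {R : Type*} [CommRing R] (P Q : PrimeSpectrum R) :
    Q ∈ Module.support R (R ⧸ P.asIdeal) ↔ P ≤ Q := by
  rw [Module.support_eq_zeroLocus, Ideal.annihilator_quotient]
  exact Iff.rfl

namespace SerreSubcategory

variable {R : Type u} [CommRing R] [IsNoetherianRing R]

/-- The finitely generated modules whose support is contained in `W`. The set `W` is arbitrary:
as supports are stable under specialisation, only the largest specialisation-closed subset of `W`
matters. -/
def ofSupport (W : Set (PrimeSpectrum R)) : SerreSubcategory (FGModuleCat.{u} R) where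
  val M := Module.support R M ⊆ W
  property :=
    { exists_zero := ⟨FGModuleCat.of R PUnit.{u + 1},
        (Limits.IsZero.iff_id_eq_zero _).2 (FGModuleCat.hom_ext (Subsingleton.elim _ _)),
        (Module.support_eq_empty (R := R) (M := PUnit.{u + 1})).trans_subset W.empty_subset⟩
      prop_of_mono f _ h :=
        (Module.support_subset_of_injective _ (FGModuleCat.injective_of_mono f)).trans h
      prop_of_epi f _ h :=
        (Module.support_subset_of_surjective _ (FGModuleCat.surjective_of_epi f)).trans h
      prop_X₂_of_shortExact {E} hE h₁ h₃ := by
        have := hE.mono_f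
        have := hE.epi_g
        have key := Module.support_of_exact (FGModuleCat.function_exact_of_shortExact hE)
          (FGModuleCat.injective_of_mono E.f) (FGModuleCat.surjective_of_epi E.g)
        exact key.trans_subset (Set.union_subset h₁ h₃) }

theorem ofSupport_mono {W W' : Set (PrimeSpectrum R)} (h : W ⊆ W') :
    ofSupport W ≤ ofSupport W' :=
  fun _ hM => Set.Subset.trans hM h

theorem ofSupport_inf (W W' : Set (PrimeSpectrum R)) :
    ofSupport W ⊓ ofSupport W' = ofSupport (W ∩ W') :=
  le_antisymm (fun _ h => Set.subset_inter h.1 h.2)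
    (le_inf (ofSupport_mono Set.inter_subset_left) (ofSupport_mono Set.inter_subset_right))

/-- The set of the prime ideals `P` such that `R ⧸ P` belongs to `S`. -/
def primes (S : SerreSubcategory (FGModuleCat.{u} R)) : Set (PrimeSpectrum R) :=
  {P | S.1 (FGModuleCat.of R (R ⧸ P.asIdeal))}

/-- If the annihilator of `m : M` is contained in `P`, then `R ⧸ P` is a quotient of the submodule
`R m ≃ R ⧸ Ann m` of `M`. -/
theorem support_subset_primes (S : SerreSubcategory (FGModuleCat.{u} R)) {M : FGModuleCat.{u} R}
    (hM : S.1 M) : Module.support R M ⊆ S.primes := by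
  have := S.2
  intro P hP
  obtain ⟨m, hm⟩ := Module.mem_support_iff_exists_annihilator.1 hP
  let N : Submodule R M := Submodule.span R {m}
  have hN : S.1 (FGModuleCat.of R N) :=
    have := FGModuleCat.mono_ofHom (R := R) (f := N.subtype) N.injective_subtype
    S.1.prop_of_mono (FGModuleCat.ofHom N.subtype) hM
  let e := LinearMap.quotKerEquivRange (LinearMap.toSpanSingleton R M m)
  have hker : LinearMap.ker (LinearMap.toSpanSingleton R M m) ≤ P.asIdeal := by
    intro r hr
    exact hm ((Submodule.mem_annihilator_span_singleton m r).2 (by simpa using hr))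
  let q : N →ₗ[R] R ⧸ P.asIdeal :=
    Submodule.factor hker ∘ₗ e.symm.toLinearMap ∘ₗ
      (LinearEquiv.ofEq _ _ (LinearMap.range_toSpanSingleton (R := R) m).symm).toLinearMap
  have hq : Function.Surjective q :=
    (Submodule.factor_surjective hker).comp (e.symm.surjective.comp (LinearEquiv.surjective _))
  have := FGModuleCat.epi_ofHom hq
  exact S.1.prop_of_epi (FGModuleCat.ofHom q) hN

/-- `M` has a filtration with factors `R ⧸ P`, and the primes that occur in it are in the support
of `M`. -/
theorem prop_of_support_subset (S : SerreSubcategory (FGModuleCat.{u} R)) {M : FGModuleCat.{u} R}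
    (hM : Module.support R M ⊆ S.primes) : S.1 M := by
  have := S.2
  refine IsNoetherianRing.induction_on_isQuotientEquivQuotientPrime R (M := M) inferInstance
    (motive := fun N _ _ _ => Module.support R N ⊆ S.primes → S.1 (FGModuleCat.of R N))
    ?_ ?_ ?_ hM
  · intro N _ _ _ _ _
    exact S.1.prop_of_isZero
      ((Limits.IsZero.iff_id_eq_zero _).2 (FGModuleCat.hom_ext (Subsingleton.elim _ _)))
  · intro N _ _ _ P e h
    have hP : P ∈ S.primes := h (by
      rw [e.support_eq, PrimeSpectrum.mem_support_quotient_iff])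
    exact S.1.prop_of_iso e.symm.toFGModuleCatIso hP
  · intro N₁ _ _ _ N₂ _ _ _ N₃ _ _ _ f g hf hg hfg h₁ h₃ h
    rw [Module.support_of_exact hfg hf hg, Set.union_subset_iff] at h
    exact S.1.prop_X₂_of_exact (FGModuleCat.exact_of_function_exact hfg) (h₁ h.1) (h₃ h.2)

theorem prop_iff_support_subset (S : SerreSubcategory (FGModuleCat.{u} R))
    (M : FGModuleCat.{u} R) : S.1 M ↔ Module.support R M ⊆ S.primes :=
  ⟨S.support_subset_primes, S.prop_of_support_subset⟩

theorem ofSupport_primes (S : SerreSubcategory (FGModuleCat.{u} R)) : ofSupport S.primes = S :=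
  le_antisymm (fun M => (S.prop_iff_support_subset M).2) (fun M => (S.prop_iff_support_subset M).1)

theorem mem_primes_ofSupport_iff (W : Set (PrimeSpectrum R)) (P : PrimeSpectrum R) :
    P ∈ (ofSupport W).primes ↔ Set.Ici P ⊆ W :=
  forall_congr' fun Q => imp_congr_left (PrimeSpectrum.mem_support_quotient_iff P Q)

/-! ### The Serre subcategory of the modules whose support avoids a prime -/

/-- The finitely generated modules `M` with `M_P = 0`, encoded as those whose support contains no
prime below `P`. -/
def avoiding (P : PrimeSpectrum R) : SerreSubcategory (FGModuleCat.{u} R) :=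
  ofSupport {Q | ¬ Q ≤ P}

theorem avoiding_prop_iff (P : PrimeSpectrum R) (M : FGModuleCat.{u} R) :
    (avoiding P).1 M ↔ P ∉ Module.support R M :=
  ⟨fun h hP => h hP le_rfl, fun h _ hQ hQP => h (Module.mem_support_mono hQP hQ)⟩

theorem mem_primes_avoiding_iff (P Q : PrimeSpectrum R) : Q ∈ (avoiding P).primes ↔ ¬ Q ≤ P :=
  (avoiding_prop_iff P _).trans (PrimeSpectrum.mem_support_quotient_iff Q P).not

/-- `avoiding P` is the largest Serre subcategory that does not contain `R ⧸ P`. -/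
theorem le_avoiding_iff (S : SerreSubcategory (FGModuleCat.{u} R)) (P : PrimeSpectrum R) :
    S ≤ avoiding P ↔ P ∉ S.primes :=
  ⟨fun h hP => (mem_primes_avoiding_iff P P).1 (h _ hP) le_rfl,
    fun h M hM => (avoiding_prop_iff P M).2 fun hP => h (S.support_subset_primes hM hP)⟩

theorem avoiding_le_avoiding_iff (P Q : PrimeSpectrum R) :
    avoiding P ≤ avoiding Q ↔ Q ≤ P := by
  rw [le_avoiding_iff, mem_primes_avoiding_iff, not_not]

theorem avoiding_infPrime (P : PrimeSpectrum R) : InfPrime (avoiding P) := by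
  refine ⟨fun h => ?_, fun S T hST => ?_⟩
  · have hle := h (ofSupport_mono (Set.subset_univ {Q | ¬ Q ≤ P}))
    exact (le_avoiding_iff _ P).1 hle
      ((mem_primes_ofSupport_iff Set.univ P).2 (Set.subset_univ _))
  · simp only [le_avoiding_iff] at hST ⊢
    by_contra! h
    exact hST h

/-- The prime is a maximal element of the complement of `S.primes`. -/
theorem exists_eq_avoiding_of_infIrred {S : SerreSubcategory (FGModuleCat.{u} R)}
    (hS : InfIrred S) : ∃ P, avoiding P = S := by
  have hne : S.primesᶜ.Nonempty := by
    by_contra! h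
    refine hS.1 fun T _ M _ => S.prop_of_support_subset ?_
    rw [Set.compl_empty_iff.1 h]
    exact Set.subset_univ _
  have hwf : WellFounded ((· > ·) : PrimeSpectrum R → PrimeSpectrum R → Prop) :=
    InvImage.wf PrimeSpectrum.asIdeal wellFounded_gt
  obtain ⟨P, hP, hmax⟩ := hwf.has_min S.primesᶜ hne
  have hinter : (S.primes ∪ Set.Ici P) ∩ (S.primes ∪ {Q | ¬ Q ≤ P}) = S.primes := by
    refine Set.Subset.antisymm ?_ (Set.subset_inter Set.subset_union_left Set.subset_union_left)
    rintro Q ⟨hQ | hPQ, hQ' | hQP⟩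
    · exact hQ
    · exact hQ
    · exact hQ'
    · by_contra hQ
      exact hmax Q hQ (lt_of_le_not_ge hPQ hQP)
  refine ⟨P, ?_⟩
  have hinf := ofSupport_inf (S.primes ∪ Set.Ici P) (S.primes ∪ {Q | ¬ Q ≤ P})
  rw [hinter, ofSupport_primes] at hinf
  -- The first alternative is impossible, as `P` lies in `Set.Ici P` but not in `S.primes`.
  rcases hS.2 hinf with h | h
  · exact absurd (h ▸ (mem_primes_ofSupport_iff _ P).2 Set.subset_union_right) hP
  · exact le_antisymm ((ofSupport_mono Set.subset_union_right).trans_eq h)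
      ((le_avoiding_iff S P).2 hP)

theorem infPrime_iff_infIrred (S : SerreSubcategory (FGModuleCat.{u} R)) :
    InfPrime S ↔ InfIrred S := by
  refine ⟨InfPrime.infIrred, fun hS => ?_⟩
  obtain ⟨P, rfl⟩ := exists_eq_avoiding_of_infIrred hS
  exact avoiding_infPrime P

theorem avoiding_bijective : Function.Bijective
    fun P : PrimeSpectrum R =>
      (⟨avoiding P, avoiding_infPrime P⟩ : SerreSpectrum (FGModuleCat.{u} R)) := by
  refine ⟨fun P Q h => ?_, fun S => ?_⟩
  · have h' : avoiding P = avoiding Q := congrArg Subtype.val h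
    exact le_antisymm ((avoiding_le_avoiding_iff Q P).1 h'.ge)
      ((avoiding_le_avoiding_iff P Q).1 h'.le)
  · obtain ⟨P, hP⟩ := exists_eq_avoiding_of_infIrred S.2.infIrred
    exact ⟨P, Subtype.ext hP⟩

end SerreSubcategory

/-! ### Maps to the injective hull of `R ⧸ P` -/

/-- If `f m ≠ 0`, essentiality moves a multiple of `f m` to a nonzero element of `R ⧸ P`, whose
annihilator is `P`. Conversely, if the annihilator of `m` is contained in `P`, the map
`R m → R ⧸ P ⊆ E` sending `m` to `1` extends to `M`. -/
theorem exists_linearMap_ne_zero_iff_mem_support {R : Type u} [CommRing R] {P : PrimeSpectrum R}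
    {E : Type u} [AddCommGroup E] [Module R E] {i : (R ⧸ P.asIdeal) →ₗ[R] E}
    (hi : IsInjectiveHull i) (M : Type u) [AddCommGroup M] [Module R M] :
    (∃ f : M →ₗ[R] E, f ≠ 0) ↔ P ∈ Module.support R M := by
  rw [Module.mem_support_iff_exists_annihilator]
  constructor
  · rintro ⟨f, hf⟩
    obtain ⟨m, hm⟩ : ∃ m, f m ≠ 0 := by
      by_contra! h
      exact hf (LinearMap.ext h)
    obtain ⟨x, hx, hx0⟩ := Submodule.exists_mem_ne_zero_of_ne_bot fun h =>
      hm (Submodule.span_singleton_eq_bot.1 (hi.essential (Submodule.span R {f m}) h))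
    obtain ⟨r, rfl⟩ := Submodule.mem_span_singleton.1 hx.1
    obtain ⟨y, hy⟩ := hx.2
    obtain ⟨a, rfl⟩ := Ideal.Quotient.mk_surjective y
    have ha : a ∉ P.asIdeal := fun ha => hx0 (by
      rw [← hy, Ideal.Quotient.eq_zero_iff_mem.2 ha, map_zero])
    refine ⟨m, fun s hs => ?_⟩
    rw [Submodule.mem_annihilator_span_singleton] at hs
    have hsa : i (Ideal.Quotient.mk P.asIdeal (s * a)) = 0 := by
      have h1 : Ideal.Quotient.mk P.asIdeal (s * a) = s • Ideal.Quotient.mk P.asIdeal a := rfl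
      rw [h1, map_smul, hy, smul_comm, ← map_smul, hs, map_zero, smul_zero]
    rw [← map_zero i] at hsa
    have hsa' : s * a ∈ P.asIdeal := Ideal.Quotient.eq_zero_iff_mem.1 (hi.injective_map hsa)
    exact (P.isPrime.mem_or_mem hsa').resolve_right ha
  · rintro ⟨m, hm⟩
    let t := LinearMap.toSpanSingleton R M m
    have hker : LinearMap.ker t ≤ P.asIdeal := fun r hr =>
      hm ((Submodule.mem_annihilator_span_singleton m r).2 (by simpa [t] using hr))
    obtain ⟨f, hf⟩ := hi.injective_module.out ((LinearMap.ker t).liftQ t le_rfl)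
      (LinearMap.ker_eq_bot.1 (Submodule.ker_liftQ_eq_bot' _ _ rfl))
      (i ∘ₗ Submodule.factor hker)
    refine ⟨f, ?_⟩
    rintro rfl
    have h1 : i (Ideal.Quotient.mk P.asIdeal 1) = 0 := (hf (Submodule.Quotient.mk 1)).symm
    rw [← map_zero i] at h1
    exact P.isPrime.ne_top
      ((Ideal.eq_top_iff_one _).2 (Ideal.Quotient.eq_zero_iff_mem.1 (hi.injective_map h1)))

theorem proposition2p9 (R : Type u) [CommRing R] [IsNoetherianRing R] :
    (∀ S : SerreSubcategory (FGModuleCat.{u} R), InfPrime S ↔ InfIrred S) ∧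
    ∃ Φ : PrimeSpectrum R ≃ SerreSpectrum (FGModuleCat.{u} R),
      (∀ (P : PrimeSpectrum R) (A : FGModuleCat.{u} R),
        (Φ P).1.1 A ↔ ∀ f : A →ₗ[R] injectiveHull R (R ⧸ P.asIdeal), f = 0) ∧
      (∀ P Q : PrimeSpectrum R, Φ P ≤ Φ Q ↔ Q.asIdeal ≤ P.asIdeal) ∧
      (∀ P Q : PrimeSpectrum R, Φ P ≤ Φ Q ↔ P ∈ closure {Q}) := by
  refine ⟨SerreSubcategory.infPrime_iff_infIrred,
    Equiv.ofBijective _ SerreSubcategory.avoiding_bijective, fun P A => ?_,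
    SerreSubcategory.avoiding_le_avoiding_iff, fun P Q => ?_⟩
  · refine (SerreSubcategory.avoiding_prop_iff P A).trans ?_
    rw [← exists_linearMap_ne_zero_iff_mem_support (isInjectiveHull_toInjectiveHull R _)]
    push Not
    exact Iff.rfl
  · rw [← PrimeSpectrum.le_iff_mem_closure]
    exact SerreSubcategory.avoiding_le_avoiding_iff P Q
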